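/- Let $E$ be a real or complex Banach space, with scalar field $\mathbb K\in\{\mathbb R,\mathbb C\}$; all Banach spaces $F$ below are over the same field. For $k\in\mathbb N=\{1,2,\dots\}$ and a Banach space $F$, let $\mathcal P(^kE,F)$ be the space of continuous $k$-homogeneous polynomials from $E$ to $F$, that is, of the maps $P(x)=A(x,\dots,x)$ with $A:E^k\to F$ continuous and $k$-linear, with norm $\|P\|=\sup_{\|x\|\le 1}\|P(x)\|$; put $\mathcal P(^kE)=\mathcal P(^kE,\mathbb K)$. A series $\sum_i x_i$ in $E$ is weakly unconditionally Cauchy if $\sum_i|f(x_i)|<\infty$ for every $f\in E^*$; a series in $F$ is unconditionally converging if each of its subseries is norm convergent. Let $\mathcal P_{uc}(^kE,F)$ be the set of all $P\in\mathcal P(^kE,F)$ such that $\sum_i P(x_i)$ is unconditionally converging whenever $\sum_i x_i$ is weakly unconditionally Cauchy, and let $\mathcal P_{wco}(^kE,F)$ be the set of all $P\in\mathcal P(^kE,F)$ that map bounded sets to relatively weakly compact sets. The space $E$ has the polynomial property (V) if $\mathcal P_{uc}(^kE,F)\subseteq\mathcal P_{wco}(^kE,F)$ for every $k\in\mathbb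 N$ and every Banach space $F$. Then: 1. For every integer $k>1$: the inclusion $\mathcal P_{uc}(^kE,F)\subseteq\mathcal P_{wco}(^kE,F)$ holds for every Banach space $F$ if and only if $\mathcal P(^kE)$ is reflexive. 2. $E$ has the polynomial property (V) if and only if $\mathcal P(^kE)$ is reflexive for every $k\in\mathbb N$. -/

import Mathlib

open Filter Topology

universe u

noncomputable section

namespace BanachPoly

/-- The linear map sending a continuous `k`-linear map `A` on `E` to its restriction to the
diagonal, `x ↦ A (x, …, x)`. -/
def diagonal (𝕜 : Type*) [RCLike 𝕜] (k : ℕ) (E F : Type*)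
    [NormedAddCommGroup E] [NormedSpace 𝕜 E] [NormedAddCommGroup F] [NormedSpace 𝕜 F] :
    ContinuousMultilinearMap 𝕜 (fun _ : Fin k => E) F →ₗ[𝕜] (E → F) where
  toFun A := fun x => A (fun _ => x)
  map_add' _ _ := rfl
  map_smul' _ _ := rfl

/-- The space of continuous `k`-homogeneous polynomials from `E` to `F`: the functions `P : E → F`
of the form `P x = A (x, …, x)` for some continuous `k`-linear map `A`. It is a type of its own (not
reducible to a subtype of `E → F`) so that it does not carry the topology of pointwise
convergence. -/
def HomPoly (𝕜 : Type*) [RCLike 𝕜] (k : ℕ) (E F : Type*)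
    [NormedAddCommGroup E] [NormedSpace 𝕜 E] [NormedAddCommGroup F] [NormedSpace 𝕜 F] : Type _ :=
  LinearMap.range (diagonal 𝕜 k E F)

namespace HomPoly

variable {𝕜 : Type*} [RCLike 𝕜] {k : ℕ} {E F : Type*}
  [NormedAddCommGroup E] [NormedSpace 𝕜 E] [NormedAddCommGroup F] [NormedSpace 𝕜 F]

instance : AddCommGroup (HomPoly 𝕜 k E F) :=
  inferInstanceAs (AddCommGroup (LinearMap.range (diagonal 𝕜 k E F)))

instance : Module 𝕜 (HomPoly 𝕜 k E F) :=
  inferInstanceAs (Module 𝕜 (LinearMap.range (diagonal 𝕜 k E F)))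

instance : FunLike (HomPoly 𝕜 k E F) E F where
  coe P := P.1
  coe_injective _ _ h := Subtype.ext h

theorem add_apply (P Q : HomPoly 𝕜 k E F) (x : E) : (P + Q) x = P x + Q x := rfl

theorem smul_apply (c : 𝕜) (P : HomPoly 𝕜 k E F) (x : E) : (c • P) x = c • P x := rfl

theorem zero_apply (x : E) : (0 : HomPoly 𝕜 k E F) x = 0 := rfl

theorem exists_multilinear (P : HomPoly 𝕜 k E F) :
    ∃ A : ContinuousMultilinearMap 𝕜 (fun _ : Fin k => E) F, ∀ x, P x = A (fun _ => x) := by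
  obtain ⟨A, hA⟩ := P.2
  exact ⟨A, fun x => (congrFun hA x).symm⟩

theorem map_smul (P : HomPoly 𝕜 k E F) (c : 𝕜) (x : E) : P (c • x) = c ^ k • P x := by
  obtain ⟨A, hA⟩ := P.exists_multilinear
  rw [hA, hA]
  simpa using A.map_smul_univ (fun _ => c) (fun _ => x)

/-- The norm `‖P‖ = sup {‖P x‖ : ‖x‖ ≤ 1}`. -/
instance : Norm (HomPoly 𝕜 k E F) where
  norm P := ⨆ x : Metric.closedBall (0 : E) 1, ‖P (x : E)‖

theorem norm_def (P : HomPoly 𝕜 k E F) :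
    ‖P‖ = ⨆ x : Metric.closedBall (0 : E) 1, ‖P (x : E)‖ := rfl

theorem bddAbove (P : HomPoly 𝕜 k E F) :
    BddAbove (Set.range fun x : Metric.closedBall (0 : E) 1 => ‖P (x : E)‖) := by
  obtain ⟨A, hA⟩ := P.exists_multilinear
  refine ⟨‖A‖, ?_⟩
  rintro _ ⟨⟨x, hx⟩, rfl⟩
  have hx' : ‖x‖ ≤ 1 := by simpa using hx
  change ‖P x‖ ≤ ‖A‖
  rw [hA x]
  refine (A.le_opNorm _).trans ?_
  refine mul_le_of_le_one_right (norm_nonneg A) ?_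
  exact Finset.prod_le_one (fun _ _ => norm_nonneg _) (fun _ _ => hx')

theorem norm_apply_le (P : HomPoly 𝕜 k E F) {x : E} (hx : ‖x‖ ≤ 1) : ‖P x‖ ≤ ‖P‖ :=
  le_ciSup P.bddAbove ⟨x, by simpa using hx⟩

theorem eq_zero_of_norm (P : HomPoly 𝕜 k E F) (h : ‖P‖ = 0) : P = 0 := by
  refine DFunLike.ext _ _ fun x => ?_
  rw [zero_apply]
  have hball : ∀ y : E, ‖y‖ ≤ 1 → P y = 0 := fun y hy =>
    norm_le_zero_iff.mp (h ▸ P.norm_apply_le hy)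
  by_cases hx : x = 0
  · exact hball x (by simp [hx])
  · have hn : (‖x‖ : 𝕜) ≠ 0 := by simpa using hx
    have hy : ‖((‖x‖ : 𝕜)⁻¹) • x‖ ≤ 1 := by
      rw [norm_smul, norm_inv, RCLike.norm_ofReal, abs_norm,
        inv_mul_cancel₀ (norm_ne_zero_iff.mpr hx)]
    have h1 : x = (‖x‖ : 𝕜) • (((‖x‖ : 𝕜)⁻¹) • x) := by
      rw [smul_smul, mul_inv_cancel₀ hn, one_smul]
    rw [h1, map_smul, hball _ hy, smul_zero]

theorem normedCore : NormedSpace.Core 𝕜 (HomPoly 𝕜 k E F) where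
  norm_nonneg _ := Real.iSup_nonneg fun _ => norm_nonneg _
  norm_smul c P := by
    simp only [norm_def, smul_apply, norm_smul]
    exact (Real.mul_iSup_of_nonneg (norm_nonneg c) _).symm
  norm_triangle P Q := by
    have : Nonempty (Metric.closedBall (0 : E) 1) := ⟨⟨0, by simp⟩⟩
    refine ciSup_le fun x => ?_
    have hx : ‖(x : E)‖ ≤ 1 := mem_closedBall_zero_iff.mp x.2
    rw [add_apply]
    exact (norm_add_le _ _).trans (add_le_add (P.norm_apply_le hx) (Q.norm_apply_le hx))
  norm_eq_zero_iff P := by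
    refine ⟨P.eq_zero_of_norm, ?_⟩
    rintro rfl
    simp [norm_def, zero_apply]

instance : NormedAddCommGroup (HomPoly 𝕜 k E F) := NormedAddCommGroup.ofCore normedCore

instance : NormedSpace 𝕜 (HomPoly 𝕜 k E F) := NormedSpace.ofCore normedCore

end HomPoly

/-- A normed space is reflexive if its canonical embedding into its bidual is onto. -/
def IsReflexive (𝕜 : Type*) [RCLike 𝕜] (X : Type*) [NormedAddCommGroup X] [NormedSpace 𝕜 X] :
    Prop :=
  Function.Surjective (NormedSpace.inclusionInDoubleDual 𝕜 X)

/-- The series `∑ x i` is weakly unconditionally Cauchy: `∑ |f (x i)| < ∞` for every continuous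
linear functional `f`. -/
def IsWUC (𝕜 : Type*) [RCLike 𝕜] {E : Type*} [NormedAddCommGroup E] [NormedSpace 𝕜 E]
    (x : ℕ → E) : Prop :=
  ∀ f : StrongDual 𝕜 E, Summable fun i => ‖f (x i)‖

/-- The series `∑ x i` is unconditionally converging: every subseries is norm convergent. -/
def IsUC {F : Type*} [NormedAddCommGroup F] (x : ℕ → F) : Prop :=
  ∀ n : ℕ → ℕ, StrictMono n →
    ∃ y : F, Tendsto (fun N => ∑ i ∈ Finset.range N, x (n i)) atTop (𝓝 y)

/-- The unconditionally converging `k`-homogeneous polynomials: those taking weakly unconditionally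
Cauchy series to unconditionally converging series. -/
def UncondConvPoly (𝕜 : Type*) [RCLike 𝕜] (k : ℕ) (E F : Type*)
    [NormedAddCommGroup E] [NormedSpace 𝕜 E] [NormedAddCommGroup F] [NormedSpace 𝕜 F] :
    Set (HomPoly 𝕜 k E F) :=
  {P | ∀ x : ℕ → E, IsWUC 𝕜 x → IsUC fun i => P (x i)}

/-- The weakly compact `k`-homogeneous polynomials: those taking bounded sets to relatively weakly
compact sets. -/
def WeaklyCompactPoly (𝕜 : Type*) [RCLike 𝕜] (k : ℕ) (E F : Type*)
    [NormedAddCommGroup E] [NormedSpace 𝕜 E] [NormedAddCommGroup F] [NormedSpace 𝕜 F] :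
    Set (HomPoly 𝕜 k E F) :=
  {P | ∀ S : Set E, Bornology.IsBounded S →
    IsCompact (closure (toWeakSpace 𝕜 F '' (P '' S)))}

/-- The polynomial property (V): for every `k ≥ 1` and every Banach space `F`, all unconditionally
converging `k`-homogeneous polynomials from `E` to `F` are weakly compact. -/
def PolynomialPropertyV (𝕜 : Type*) [RCLike 𝕜] (E : Type u)
    [NormedAddCommGroup E] [NormedSpace 𝕜 E] : Prop :=
  ∀ k : ℕ, 1 ≤ k → ∀ (F : Type u) [NormedAddCommGroup F] [NormedSpace 𝕜 F] [CompleteSpace F],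
    UncondConvPoly 𝕜 k E F ⊆ WeaklyCompactPoly 𝕜 k E F

end BanachPoly

end

/-! Reflexivity gives more than is asked: every polynomial `P : E → F` is then weakly compact.
Composition with `P` maps `F*` to the scalar polynomials, and the adjoint `T` of that map sends
evaluation at `x` to the image of `P x` in `F**`. A functional on `F**` that vanishes on `F`,
composed with `T`, is by reflexivity a scalar polynomial `Q` which is zero at every point, so `T`
takes its values in `F`. The resulting map is weak*-to-weak continuous, and dual balls are weak*
compact (`mem_weaklyCompactPoly_of_isReflexive`).

Conversely, let `k > 1`. For a functional `φ` the polynomial `φ(x)^(k-1) x` is unconditionally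
converging, because `φ(x_i)` is absolutely summable. Hence it is weakly compact; it is the identity
on the hyperplane `φ = 1`, and this forces weakly unconditionally Cauchy series to have weak sums
(`hasWeakSums_of_powSMul_mem`). A Baire category argument of Orlicz–Pettis type turns weak sums into
uniformly small tails (`HasWeakSums.exists_norm_sum_le`), and averaging over signs carries the
smallness to every homogeneous polynomial of positive degree (`mem_uncondConvPoly_of_hasWeakSums`).
So all of these are unconditionally converging, in particular the evaluation `δ` from `E` to the
dual of the scalar polynomials, which is therefore weakly compact.

The evaluations determine the norm of the scalar polynomials, and a relatively weakly compact
norming set spans a dense subspace of the dual (`mem_closure_span_of_isCompact_closure`, which rests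
on a Simons type inequality). A functional `Φ` on that dual agrees on evaluations with the
polynomial `Φ ∘ δ`, hence is equal to it everywhere by density: the polynomials are reflexive. -/

noncomputable section

namespace BanachPoly

/-! ### Polarization and the evaluation polynomial -/

open Finset in
/-- The polarization formula: a multilinear map is determined, up to symmetrization, by its
restriction to the diagonal. -/
theorem sum_perm_eq_polarization {R : Type*} [CommRing R] {k : ℕ} {E F : Type*}
    [AddCommGroup E] [Module R E] [AddCommGroup F] [Module R F]
    (A : MultilinearMap R (fun _ : Fin k => E) F) (x : Fin k → E) :
    ∑ σ : Equiv.Perm (Fin k), A (fun i => x (σ i)) =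
      ∑ U : Finset (Fin k), (-1 : ℤ) ^ #U • A (fun _ => ∑ i ∈ Uᶜ, x i) := by
  classical
  have h1 : ∀ U : Finset (Fin k), A (fun _ => ∑ i ∈ Uᶜ, x i) =
      ∑ r : Fin k → Fin k, if U ⊆ (univ.image r)ᶜ then A (fun i => x (r i)) else 0 := by
    intro U
    rw [A.map_sum_finset (fun _ j => x j) (fun _ => Uᶜ), ← Finset.sum_filter]
    refine Finset.sum_congr ?_ fun _ _ => rfl
    ext r
    simp only [Fintype.mem_piFinset, mem_compl, mem_filter, mem_univ, true_and, subset_iff,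
      mem_image, not_exists]
    exact ⟨fun h a ha i hi => h i (hi ▸ ha), fun h i hi => h hi i rfl⟩
  -- The coefficient of the term of `r` is an alternating sum over the subsets of the complement of
  -- its image; it vanishes unless `r` is onto, that is, a permutation.
  have h2 : ∀ r : Fin k → Fin k,
      ∑ U : Finset (Fin k), (-1 : ℤ) ^ #U •
        (if U ⊆ (univ.image r)ᶜ then A (fun i => x (r i)) else 0) =
      if Function.Bijective r then A (fun i => x (r i)) else 0 := by
    intro r
    have h3 : ∑ U : Finset (Fin k), (-1 : ℤ) ^ #U •
        (if U ⊆ (univ.image r)ᶜ then A (fun i => x (r i)) else 0) =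
        (∑ U ∈ ((univ.image r)ᶜ).powerset, (-1 : ℤ) ^ #U) • A (fun i => x (r i)) := by
      rw [Finset.sum_smul]
      simp only [smul_ite, smul_zero]
      rw [← Finset.sum_filter]
      refine Finset.sum_congr ?_ fun _ _ => rfl
      ext U
      simp
    rw [h3, sum_powerset_neg_one_pow_card]
    have h4 : (univ.image r)ᶜ = ∅ ↔ Function.Bijective r := by
      rw [compl_eq_empty_iff, ← Finite.surjective_iff_bijective]
      simp [Finset.ext_iff, Function.Surjective]
    simp only [h4]
    split_ifs <;> simp
  simp only [h1, Finset.smul_sum]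
  rw [Finset.sum_comm]
  simp only [h2]
  rw [← Finset.sum_filter]
  refine Finset.sum_bij (fun σ _ => σ)
    (fun σ _ => mem_filter.mpr ⟨mem_univ _, σ.bijective⟩) ?_ ?_ fun _ _ => rfl
  · intro σ _ τ _ h
    exact DFunLike.coe_injective h
  · intro r hr
    exact ⟨Equiv.ofBijective r (mem_filter.mp hr).2, mem_univ _, rfl⟩

namespace HomPoly

variable {𝕜 : Type*} [RCLike 𝕜] {k : ℕ} {E F : Type*}
  [NormedAddCommGroup E] [NormedSpace 𝕜 E] [NormedAddCommGroup F] [NormedSpace 𝕜 F]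

theorem norm_apply_le_pow (P : HomPoly 𝕜 k E F) (x : E) : ‖P x‖ ≤ ‖P‖ * ‖x‖ ^ k := by
  by_cases hx : x = 0
  · subst hx
    rcases Nat.eq_zero_or_pos k with rfl | hk
    · simpa using P.norm_apply_le (x := 0) (by simp)
    · have h := P.map_smul 0 0
      rw [zero_pow hk.ne', zero_smul, zero_smul] at h
      rw [h, norm_zero]
      positivity
  · have hn : (‖x‖ : 𝕜) ≠ 0 := by simpa using hx
    have h1 : x = (‖x‖ : 𝕜) • (((‖x‖ : 𝕜)⁻¹) • x) := by
      rw [smul_smul, mul_inv_cancel₀ hn, one_smul]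
    have hy : ‖((‖x‖ : 𝕜)⁻¹) • x‖ ≤ 1 := by
      rw [norm_smul, norm_inv, RCLike.norm_ofReal, abs_norm,
        inv_mul_cancel₀ (norm_ne_zero_iff.mpr hx)]
    conv_lhs => rw [h1]
    rw [map_smul, norm_smul, norm_pow, RCLike.norm_ofReal, abs_norm, mul_comm]
    gcongr
    exact P.norm_apply_le hy

theorem norm_le_of_forall (P : HomPoly 𝕜 k E F) {C : ℝ} (h : ∀ x, ‖x‖ ≤ 1 → ‖P x‖ ≤ C) :
    ‖P‖ ≤ C := by
  have : Nonempty (Metric.closedBall (0 : E) 1) := ⟨⟨0, by simp⟩⟩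
  exact ciSup_le fun x => h x (mem_closedBall_zero_iff.mp x.2)

/-- The homogeneous polynomial `x ↦ A (x, …, x)`. -/
def ofMultilinear (A : ContinuousMultilinearMap 𝕜 (fun _ : Fin k => E) F) : HomPoly 𝕜 k E F :=
  ⟨diagonal 𝕜 k E F A, A, rfl⟩

@[simp] theorem ofMultilinear_apply (A : ContinuousMultilinearMap 𝕜 (fun _ : Fin k => E) F)
    (x : E) : ofMultilinear A x = A (fun _ => x) := rfl

/-- The symmetrization of a continuous multilinear map. -/
def symmetrize (A : ContinuousMultilinearMap 𝕜 (fun _ : Fin k => E) F) :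
    ContinuousMultilinearMap 𝕜 (fun _ : Fin k => E) F :=
  ((k.factorial : 𝕜)⁻¹) • ∑ σ : Equiv.Perm (Fin k), A.domDomCongr σ

theorem symmetrize_apply (A : ContinuousMultilinearMap 𝕜 (fun _ : Fin k => E) F)
    (x : Fin k → E) : symmetrize A x =
      ((k.factorial : 𝕜)⁻¹) • ∑ σ : Equiv.Perm (Fin k), A (fun i => x (σ i)) := by
  simp [symmetrize]

theorem symmetrize_diagonal (A : ContinuousMultilinearMap 𝕜 (fun _ : Fin k => E) F) (x : E) :
    symmetrize A (fun _ => x) = A (fun _ => x) := by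
  rw [symmetrize_apply, Finset.sum_const, Finset.card_univ, Fintype.card_perm, Fintype.card_fin,
    ← Nat.cast_smul_eq_nsmul 𝕜, smul_smul, inv_mul_cancel₀, one_smul]
  exact_mod_cast k.factorial_ne_zero

-- The right-hand side involves `P` alone, so the symmetrization does not depend on the
-- representative `A`; this is what makes `toMultilinear` linear.
open Finset in
theorem symmetrize_apply_of_eq {P : HomPoly 𝕜 k E F}
    {A : ContinuousMultilinearMap 𝕜 (fun _ : Fin k => E) F} (h : ∀ x, P x = A fun _ => x)
    (x : Fin k → E) : symmetrize A x = ((k.factorial : 𝕜)⁻¹) •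
      ∑ U : Finset (Fin k), (-1 : ℤ) ^ #U • P (∑ i ∈ Uᶜ, x i) := by
  rw [symmetrize_apply]
  have := sum_perm_eq_polarization A.toMultilinearMap x
  simp only [ContinuousMultilinearMap.coe_coe] at this
  rw [this]
  simp only [h]

/-- A constant bounding the norm of the symmetric multilinear map of a polynomial. -/
def polarizationConst (k : ℕ) : ℝ := 2 ^ k * (k : ℝ) ^ k

theorem norm_symmetrize_apply_le {P : HomPoly 𝕜 k E F}
    {A : ContinuousMultilinearMap 𝕜 (fun _ : Fin k => E) F} (h : ∀ x, P x = A fun _ => x)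
    (x : Fin k → E) (hx : ∀ i, ‖x i‖ ≤ 1) :
    ‖symmetrize A x‖ ≤ polarizationConst k * ‖P‖ := by
  rw [symmetrize_apply_of_eq h, norm_smul]
  have h1 : ‖((k.factorial : 𝕜)⁻¹)‖ ≤ 1 := by
    rw [norm_inv, RCLike.norm_natCast]
    exact inv_le_one_of_one_le₀ (by exact_mod_cast k.factorial_pos)
  -- Each partial sum has norm at most `k`, and there are `2 ^ k` subsets; the factor `1 / k!` is
  -- only bounded by one.
  have h2 : ∀ U : Finset (Fin k), ‖(-1 : ℤ) ^ U.card • P (∑ i ∈ Uᶜ, x i)‖ ≤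
      (k : ℝ) ^ k * ‖P‖ := by
    intro U
    have h3 : ‖(-1 : ℤ) ^ U.card • P (∑ i ∈ Uᶜ, x i)‖ = ‖P (∑ i ∈ Uᶜ, x i)‖ := by
      rcases neg_one_pow_eq_or ℤ U.card with h | h <;> simp [h]
    rw [h3, mul_comm]
    refine (P.norm_apply_le_pow _).trans ?_
    gcongr
    refine (norm_sum_le_of_le _ fun i _ => hx i).trans ?_
    simp only [Finset.sum_const, nsmul_eq_mul, mul_one]
    exact_mod_cast (Finset.card_le_univ _).trans (by simp)
  calc _ ≤ 1 * ∑ U : Finset (Fin k), (k : ℝ) ^ k * ‖P‖ := by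
        gcongr
        exact norm_sum_le_of_le _ fun U _ => h2 U
    _ = _ := by simp [polarizationConst, mul_assoc]

theorem norm_symmetrize_le {P : HomPoly 𝕜 k E F}
    {A : ContinuousMultilinearMap 𝕜 (fun _ : Fin k => E) F} (h : ∀ x, P x = A fun _ => x) :
    ‖symmetrize A‖ ≤ polarizationConst k * ‖P‖ := by
  have hC : 0 ≤ polarizationConst k * ‖P‖ := by
    rw [polarizationConst]
    positivity
  refine ContinuousMultilinearMap.opNorm_le_bound hC fun x => ?_
  by_cases hx : ∃ i, x i = 0
  · obtain ⟨i, hi⟩ := hx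
    rw [(symmetrize A).map_coord_zero i hi, norm_zero]
    positivity
  · push Not at hx
    have h1 : x = fun i => (‖x i‖ : 𝕜) • (((‖x i‖ : 𝕜)⁻¹) • x i) := by
      funext i
      rw [smul_smul, mul_inv_cancel₀ (by simpa using hx i), one_smul]
    conv_lhs => rw [h1]
    rw [ContinuousMultilinearMap.map_smul_univ, norm_smul, norm_prod, mul_comm]
    simp only [RCLike.norm_ofReal, abs_norm]
    gcongr
    refine norm_symmetrize_apply_le h _ fun i => ?_
    rw [norm_smul, norm_inv, RCLike.norm_ofReal, abs_norm,
      inv_mul_cancel₀ (norm_ne_zero_iff.mpr (hx i))]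

/-- The symmetric continuous multilinear map of a homogeneous polynomial. -/
def toMultilinear :
    HomPoly 𝕜 k E F →L[𝕜] ContinuousMultilinearMap 𝕜 (fun _ : Fin k => E) F :=
  LinearMap.mkContinuous
    { toFun := fun P => symmetrize P.exists_multilinear.choose
      map_add' := fun P Q => by
        ext x
        rw [_root_.add_apply,
          symmetrize_apply_of_eq (P + Q).exists_multilinear.choose_spec,
          symmetrize_apply_of_eq P.exists_multilinear.choose_spec,
          symmetrize_apply_of_eq Q.exists_multilinear.choose_spec]
        simp only [add_apply, smul_add, Finset.sum_add_distrib]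
      map_smul' := fun c P => by
        ext x
        rw [_root_.smul_apply,
          symmetrize_apply_of_eq (c • P).exists_multilinear.choose_spec,
          symmetrize_apply_of_eq P.exists_multilinear.choose_spec]
        simp only [smul_apply, RingHom.id_apply, smul_comm _ c, ← Finset.smul_sum] }
    (polarizationConst k) fun P => norm_symmetrize_le P.exists_multilinear.choose_spec

@[simp] theorem toMultilinear_diagonal (P : HomPoly 𝕜 k E F) (x : E) :
    toMultilinear P (fun _ => x) = P x := by
  conv_rhs => rw [P.exists_multilinear.choose_spec x, ← symmetrize_diagonal]
  rfl

theorem norm_ofMultilinear_le (A : ContinuousMultilinearMap 𝕜 (fun _ : Fin k => E) F) :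
    ‖ofMultilinear A‖ ≤ ‖A‖ := by
  refine norm_le_of_forall _ fun x hx => ?_
  rw [ofMultilinear_apply]
  refine (A.le_opNorm _).trans ?_
  exact mul_le_of_le_one_right (norm_nonneg A)
    (Finset.prod_le_one (fun _ _ => norm_nonneg _) fun _ _ => hx)

/-- Evaluation of scalar-valued homogeneous polynomials, as a vector-valued homogeneous
polynomial. -/
def evalPoly (𝕜 : Type*) [RCLike 𝕜] (k : ℕ) (E : Type*) [NormedAddCommGroup E]
    [NormedSpace 𝕜 E] : HomPoly 𝕜 k E (StrongDual 𝕜 (HomPoly 𝕜 k E 𝕜)) :=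
  ofMultilinear (toMultilinear (𝕜 := 𝕜) (k := k) (E := E) (F := 𝕜)).flipMultilinear

@[simp] theorem evalPoly_apply (x : E) (Q : HomPoly 𝕜 k E 𝕜) : evalPoly 𝕜 k E x Q = Q x := by
  simp [evalPoly]

theorem norm_evalPoly_le {x : E} (hx : ‖x‖ ≤ 1) : ‖evalPoly 𝕜 k E x‖ ≤ 1 :=
  ContinuousLinearMap.opNorm_le_bound _ zero_le_one fun Q => by
    simpa using Q.norm_apply_le hx

end HomPoly

/-! ### A Simons type inequality on compact spaces -/

section Simons

variable {K : Type*} [TopologicalSpace K] [CompactSpace K]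

theorem exists_isMax_continuousMap [Nonempty K] (g : C(K, ℝ)) : ∃ y, ∀ z, g z ≤ g y := by
  obtain ⟨y, -, hy⟩ := isCompact_univ.exists_isMaxOn Set.univ_nonempty g.continuous.continuousOn
  exact ⟨y, fun z => hy (Set.mem_univ z)⟩

/-- The maximum of a real continuous function on a compact space. -/
def maxValue [Nonempty K] (g : C(K, ℝ)) : ℝ := g (exists_isMax_continuousMap g).choose

theorem le_maxValue [Nonempty K] (g : C(K, ℝ)) (z : K) : g z ≤ maxValue g :=
  (exists_isMax_continuousMap g).choose_spec z

theorem exists_eq_maxValue [Nonempty K] (g : C(K, ℝ)) : ∃ y, g y = maxValue g := ⟨_, rfl⟩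

theorem maxValue_le_add_norm [Nonempty K] (g h : C(K, ℝ)) :
    maxValue g ≤ maxValue h + ‖g - h‖ := by
  obtain ⟨y, hy⟩ := exists_eq_maxValue g
  have h1 := le_maxValue h y
  have h2 := (le_abs_self _).trans ((g - h).norm_coe_le_norm y)
  rw [ContinuousMap.sub_apply] at h2
  linarith

theorem neg_norm_le_maxValue [Nonempty K] (g : C(K, ℝ)) : -‖g‖ ≤ maxValue g := by
  obtain ⟨y, hy⟩ := exists_eq_maxValue g
  rw [← hy]
  exact neg_le_of_neg_le ((neg_le_abs _).trans (g.norm_coe_le_norm y))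

theorem exists_almost_minimizer [Nonempty K] {S : Set C(K, ℝ)} (hS : S.Nonempty) {M : ℝ}
    (hM : ∀ g ∈ S, ‖g‖ ≤ M) (h : C(K, ℝ)) {t ε : ℝ} (ht : 0 ≤ t) (hε : 0 < ε) :
    ∃ g ∈ S, ∀ g' ∈ S, maxValue (h + t • g) ≤ maxValue (h + t • g') + ε := by
  have hne : ((fun g => maxValue (h + t • g)) '' S).Nonempty := hS.image _
  have hbd : BddBelow ((fun g => maxValue (h + t • g)) '' S) := by
    refine ⟨-(‖h‖ + t * M), ?_⟩
    rintro _ ⟨g, hg, rfl⟩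
    refine le_trans (neg_le_neg ?_) (neg_norm_le_maxValue _)
    refine (norm_add_le _ _).trans ?_
    rw [norm_smul, Real.norm_of_nonneg ht]
    gcongr
    exact hM g hg
  obtain ⟨_, ⟨g, hg, rfl⟩, hlt⟩ := exists_lt_of_csInf_lt hne (lt_add_of_pos_right _ hε)
  refine ⟨g, hg, fun g' hg' => hlt.le.trans ?_⟩
  gcongr
  exact csInf_le hbd ⟨g', hg', rfl⟩

/-- A form of Simons' inequality: if a bounded sequence of continuous functions on a compact space
tends to zero pointwise, then its convex hull contains functions that are uniformly small. -/
theorem exists_mem_convexHull_forall_lt {f : ℕ → C(K, ℝ)} {M : ℝ} (hM : ∀ n, ‖f n‖ ≤ M)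
    (h0 : ∀ y, Tendsto (fun n => f n y) atTop (𝓝 0)) {c : ℝ} (hc : 0 < c) :
    ∃ g ∈ convexHull ℝ (Set.range f), ∀ y, g y < c := by
  rcases isEmpty_or_nonempty K with hK | hK
  · exact ⟨f 0, subset_convexHull ℝ _ ⟨0, rfl⟩, fun y => hK.elim y⟩
  by_contra! hcon
  set S : ℕ → Set C(K, ℝ) := fun n => convexHull ℝ (f '' Set.Ici n) with hSdef
  have hSne : ∀ n, (S n).Nonempty := fun n =>
    ⟨f n, subset_convexHull ℝ _ ⟨n, Set.self_mem_Ici, rfl⟩⟩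
  have hSM : ∀ n, ∀ g ∈ S n, ‖g‖ ≤ M := by
    intro n g hg
    have : S n ⊆ Metric.closedBall 0 M := by
      refine convexHull_min ?_ (convex_closedBall _ _)
      rintro _ ⟨m, -, rfl⟩
      simpa using hM m
    simpa using this hg
  have hSsub : ∀ n, S (n + 1) ⊆ S n := fun n =>
    convexHull_mono (Set.image_mono (Set.Ici_subset_Ici.mpr (Nat.le_succ n)))
  -- Greedy choice: `G n` comes from the hull of the tail and nearly minimizes the maximum of the
  -- next partial sum `H (n + 1)` of `∑ 2⁻ⁿ G n`. The error `4⁻ⁿ` is small against the weight `2⁻ⁿ`.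
  have key : ∀ (n : ℕ) (h : C(K, ℝ)), ∃ g ∈ S n, ∀ g' ∈ S n,
      maxValue (h + ((1 : ℝ) / 2) ^ n • g) ≤
        maxValue (h + ((1 : ℝ) / 2) ^ n • g') + c / 12 * (1 / 4) ^ n := fun n h =>
    exists_almost_minimizer (hSne n) (hSM n) h (by positivity) (by positivity)
  choose G hGS hG using key
  let H : ℕ → C(K, ℝ) := fun n => Nat.rec 0 (fun n h => h + ((1 : ℝ) / 2) ^ n • G n h) n
  have hH0 : H 0 = 0 := rfl
  have hHs : ∀ n, H (n + 1) = H n + ((1 : ℝ) / 2) ^ n • G n (H n) := fun n => rfl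
  have hstep : ∀ n, (3 / 2) * maxValue (H (n + 1)) ≤
      (1 / 2) * maxValue (H n) + maxValue (H (n + 2)) + c / 8 * (1 / 4) ^ n := by
    intro n
    -- These weights are chosen so that `(3/2) (H n + 2⁻ⁿ g') = (1/2) H n + H (n + 2)`.
    set g' : C(K, ℝ) := ((2 : ℝ) / 3) • G n (H n) + ((1 : ℝ) / 3) • G (n + 1) (H (n + 1))
    have hg' : g' ∈ S n := (convex_convexHull ℝ _) (hGS n _) (hSsub n (hGS (n + 1) _))
      (by norm_num) (by norm_num) (by norm_num)
    have h1 := hG n (H n) g' hg'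
    rw [← hHs] at h1
    obtain ⟨y, hy⟩ := exists_eq_maxValue (H n + ((1 : ℝ) / 2) ^ n • g')
    have h2 : (3 / 2) * (H n + ((1 : ℝ) / 2) ^ n • g') y = (1 / 2) * H n y + H (n + 2) y := by
      rw [hHs (n + 1), hHs n]
      simp only [g', ContinuousMap.add_apply, ContinuousMap.smul_apply, smul_eq_mul, hHs n]
      ring
    have h3 := le_maxValue (H n) y
    have h4 := le_maxValue (H (n + 2)) y
    rw [← hy] at h1
    linarith
  -- By `hstep`, an increment of the maximum is at least half the previous one, minus `(c / 8) 4⁻ⁿ`;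
  -- the extra `4⁻ⁿ` term in the bound pays for this loss.
  have hgrow : ∀ n, c / 2 * ((1 / 2) ^ n + (1 / 4) ^ n) ≤
      maxValue (H (n + 1)) - maxValue (H n) := by
    intro n
    induction n with
    | zero =>
      obtain ⟨y, hy⟩ := hcon (G 0 0) (convexHull_mono (Set.image_subset_range _ _) (hGS 0 0))
      have h1 : H 1 = G 0 0 := by
        have := hHs 0
        rw [hH0] at this
        simpa using this
      have h2 := le_maxValue (H 1) y
      obtain ⟨z, hz⟩ := exists_eq_maxValue (H 0)
      have h3 : maxValue (H 0) = 0 := by rw [← hz, hH0]; simp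
      rw [h3, zero_add]
      rw [h1] at h2 ⊢
      simp only [pow_zero]
      linarith
    | succ n ih =>
      have := hstep n
      rw [pow_succ, pow_succ]
      linarith
  have hsumm : ∀ n, dist (H n) (H (n + 1)) ≤ M * (1 / 2) ^ n := by
    intro n
    rw [hHs, dist_self_add_right, norm_smul, norm_pow, mul_comm]
    have := hSM n _ (hGS n (H n))
    norm_num
    gcongr
  obtain ⟨h, hh⟩ := cauchySeq_tendsto_of_complete
    (cauchySeq_of_le_geometric (1 / 2) M (by norm_num) hsumm)
  -- At a maximum point `y` of the limit, `H m y` eventually grows by at most `(c / 4) 2⁻ᵐ` per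
  -- step, while the maximum of `H m` grows by at least twice that. The gap between them stays away
  -- from zero, although in the limit it is zero.
  obtain ⟨y, hy⟩ := exists_eq_maxValue h
  obtain ⟨n, hn⟩ := ((h0 y).eventually (eventually_lt_nhds (by positivity : (0 : ℝ) < c / 4))
    ).exists_forall_of_atTop
  have hGy : ∀ m ≥ n, G m (H m) y ≤ c / 4 := by
    intro m hm
    have : S m ⊆ {g | g y ≤ c / 4} := by
      refine convexHull_min ?_ ?_
      · rintro _ ⟨j, hj, rfl⟩
        exact (hn j (hm.trans hj)).le
      · intro g hg g' hg' a b ha hb hab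
        simp only [Set.mem_ofPred_eq, ContinuousMap.add_apply, ContinuousMap.smul_apply,
          smul_eq_mul] at hg hg' ⊢
        calc a * g y + b * g' y ≤ a * (c / 4) + b * (c / 4) := by gcongr
          _ = c / 4 := by rw [← add_mul, hab, one_mul]
    exact this (hGS m _)
  have hinc : ∀ m ≥ n, maxValue (H m) - H m y + c / 4 * (1 / 2) ^ m ≤
      maxValue (H (m + 1)) - H (m + 1) y := by
    intro m hm
    have h1 := hgrow m
    have h2 : H (m + 1) y = H m y + (1 / 2) ^ m * G m (H m) y := by rw [hHs]; simp
    have h3 : (1 / 2 : ℝ) ^ m * G m (H m) y ≤ (1 / 2) ^ m * (c / 4) := by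
      gcongr
      exact hGy m hm
    have h4 : 0 ≤ c / 2 * (1 / 4 : ℝ) ^ m := by positivity
    rw [mul_add] at h1
    linarith
  have hgap : ∀ m, c / 4 * (1 / 2) ^ n ≤ maxValue (H (n + 1 + m)) - H (n + 1 + m) y := by
    intro m
    induction m with
    | zero => linarith [hinc n le_rfl, le_maxValue (H n) y]
    | succ m ih =>
      have h1 := hinc (n + 1 + m) (by omega)
      have h2 : 0 ≤ c / 4 * (1 / 2 : ℝ) ^ (n + 1 + m) := by positivity
      rw [← add_assoc]
      linarith
  have hd : 0 < c / 4 * (1 / 2 : ℝ) ^ n / 2 := by positivity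
  obtain ⟨N, hN⟩ := Metric.tendsto_atTop.mp hh _ hd
  have h1 := hgap N
  have h2 := hN (n + 1 + N) (by omega)
  rw [dist_eq_norm] at h2
  have h3 := maxValue_le_add_norm (H (n + 1 + N)) h
  have h4 := (neg_le_abs _).trans ((H (n + 1 + N) - h).norm_coe_le_norm y)
  rw [ContinuousMap.sub_apply] at h4
  linarith

end Simons

/-! ### Weak sums and uniformly small tails -/

section Tails

variable {𝕜 : Type*} [RCLike 𝕜] {E F : Type*}
  [NormedAddCommGroup E] [NormedSpace 𝕜 E] [NormedAddCommGroup F] [NormedSpace 𝕜 F]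

/-- A point outside a closed subspace is separated from it by a functional vanishing on the
subspace. -/
theorem exists_dual_eq_one_of_notMem {p : Submodule 𝕜 E} (hp : IsClosed (p : Set E)) {x : E}
    (hx : x ∉ p) : ∃ f : StrongDual 𝕜 E, f x = 1 ∧ ∀ y ∈ p, f y = 0 := by
  have h1 : ‖p.mkQ x‖ ≠ 0 := by
    intro h
    have h2 := QuotientAddGroup.norm_mk_eq_zero_iff_mem_closure (S := p.toAddSubgroup).mp h
    exact hx (hp.closure_subset h2)
  obtain ⟨g, -, hg⟩ := exists_dual_vector 𝕜 (p.mkQ x) h1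
  refine ⟨((‖p.mkQ x‖ : 𝕜)⁻¹) • (g ∘L p.mkQL), ?_, fun y hy => ?_⟩
  · change ((‖p.mkQ x‖ : 𝕜)⁻¹) * g (p.mkQ x) = 1
    rw [hg, inv_mul_cancel₀ (by exact_mod_cast h1)]
  · change ((‖p.mkQ x‖ : 𝕜)⁻¹) * g (p.mkQ y) = 0
    rw [show p.mkQ y = 0 by simpa using hy, map_zero, mul_zero]

/-- All series `∑ a i • x i` with coefficients bounded by one have a weak sum. -/
def HasWeakSums (𝕜 : Type*) [RCLike 𝕜] {E : Type*} [NormedAddCommGroup E] [NormedSpace 𝕜 E]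
    (x : ℕ → E) : Prop :=
  ∀ a : ℕ → 𝕜, (∀ i, ‖a i‖ ≤ 1) →
    ∃ z : E, ∀ f : StrongDual 𝕜 E, f z = ∑' i, a i * f (x i)

theorem IsWUC.summable_mul {x : ℕ → E} (hx : IsWUC 𝕜 x) {a : ℕ → 𝕜} (ha : ∀ i, ‖a i‖ ≤ 1)
    (f : StrongDual 𝕜 E) : Summable fun i => a i * f (x i) :=
  (hx f).of_norm_bounded fun i => by
    rw [norm_mul]
    exact mul_le_of_le_one_left (norm_nonneg _) (ha i)

/-- If all series `∑ a i • x i` with coefficients bounded by one converge weakly, then their tails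
are uniformly small in norm. -/
theorem HasWeakSums.exists_norm_sum_le {x : ℕ → E} (hx : IsWUC 𝕜 x) (hw : HasWeakSums 𝕜 x)
    {ε : ℝ} (hε : 0 < ε) :
    ∃ M : ℕ, ∀ s : Finset ℕ, (∀ i ∈ s, M ≤ i) → ∀ a : ℕ → 𝕜, (∀ i, ‖a i‖ ≤ 1) →
      ‖∑ i ∈ s, a i • x i‖ ≤ ε := by
  set W : Set E := closure (Submodule.span 𝕜 (Set.range x) : Set E) with hW
  have hWsep : TopologicalSpace.IsSeparable W :=
    (Set.countable_range x).isSeparable.span.closure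
  obtain ⟨t, htc, htW⟩ := hWsep
  have hmemW : ∀ (a : ℕ → 𝕜) (z : E), (∀ f : StrongDual 𝕜 E, f z = ∑' i, a i * f (x i)) →
      z ∈ W := by
    intro a z hz
    by_contra hzW
    have hzW' : z ∉ (Submodule.span 𝕜 (Set.range x)).topologicalClosure := hzW
    obtain ⟨f, hfz, hf⟩ := exists_dual_eq_one_of_notMem
      (Submodule.isClosed_topologicalClosure _) hzW'
    have hfx : ∀ i, f (x i) = 0 := fun i =>
      hf _ (Submodule.le_topologicalClosure _ (Submodule.subset_span ⟨i, rfl⟩))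
    rw [hz f] at hfz
    simp [hfx] at hfz
  let D := Metric.closedBall (0 : 𝕜) 1
  -- Baire category on the compact space of coefficient sequences: all weak sums lie in the
  -- separable space `W`, so countably many closed sets `C e`, of sequences whose sum is `ε /
  -- 2`-close to `e`, cover it.
  let C : t → Set (ℕ → D) := fun e =>
    {a | ∀ f : StrongDual 𝕜 E, ‖(∑' i, (a i : 𝕜) * f (x i)) - f e‖ ≤ ε / 2 * ‖f‖}
  have hcont : ∀ f : StrongDual 𝕜 E, Continuous fun a : ℕ → D => ∑' i, (a i : 𝕜) * f (x i) := by
    intro f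
    refine continuous_tsum (fun i => by fun_prop) (hx f) fun i a => ?_
    rw [norm_mul]
    exact mul_le_of_le_one_left (norm_nonneg _) (mem_closedBall_zero_iff.mp (a i).2)
  have hC : ∀ e, IsClosed (C e) := by
    intro e
    simp only [C, Set.ofPred_forall]
    exact isClosed_iInter fun f =>
      isClosed_le (((hcont f).sub continuous_const).norm) continuous_const
  have hU : ⋃ e, C e = Set.univ := by
    refine Set.eq_univ_of_forall fun a => ?_
    obtain ⟨z, hz⟩ := hw (fun i => a i) fun i => mem_closedBall_zero_iff.mp (a i).2
    obtain ⟨e, het, hze⟩ := Metric.mem_closure_iff.mp (htW (hmemW _ z hz)) (ε / 2) (half_pos hε)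
    refine Set.mem_iUnion.mpr ⟨⟨e, het⟩, fun f => ?_⟩
    rw [← hz f, ← map_sub, mul_comm]
    refine (f.le_opNorm _).trans ?_
    gcongr
    rw [← dist_eq_norm]
    exact hze.le
  have : Countable t := htc
  have : CompactSpace D := isCompact_iff_compactSpace.mp (isCompact_closedBall _ _)
  have : Nonempty D := ⟨⟨0, mem_closedBall_zero_iff.mpr (by simp)⟩⟩
  obtain ⟨e, a₀, ha₀⟩ := nonempty_interior_of_iUnion_of_closed hC hU
  obtain ⟨V, hVC, hVo, haV⟩ := mem_interior.mp ha₀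
  obtain ⟨I, u, hu, hIV⟩ := isOpen_pi_iff.mp hVo a₀ haV
  refine ⟨I.sup id + 1, fun s hs a ha => ?_⟩
  have hdisj : ∀ i ∈ I, i ∉ s := fun i hi his => by
    have h1 := hs i his
    have h2 : i ≤ I.sup id := Finset.le_sup (f := id) hi
    omega
  classical
  -- A basic open set inside `C e` restricts only the coordinates in `I`, which `s` avoids. Thus `b`
  -- and `b'` both lie in `C e`, and their sums differ exactly by the sum over `s`.
  let b : ℕ → D := fun i => if i ∈ s then ⟨a i, mem_closedBall_zero_iff.mpr (ha i)⟩ else a₀ i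
  let b' : ℕ → D := fun i => if i ∈ s then ⟨0, mem_closedBall_zero_iff.mpr (by simp)⟩ else a₀ i
  have hb : b ∈ C e := hVC (hIV fun i hi => by
    have := (hu i hi).2
    simpa [b, hdisj i hi] using this)
  have hb' : b' ∈ C e := hVC (hIV fun i hi => by
    have := (hu i hi).2
    simpa [b', hdisj i hi] using this)
  refine NormedSpace.norm_le_dual_bound 𝕜 _ hε.le fun f => ?_
  have h1 : f (∑ i ∈ s, a i • x i) =
      (∑' i, (b i : 𝕜) * f (x i)) - ∑' i, (b' i : 𝕜) * f (x i) := by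
    rw [← (hx.summable_mul (fun i => mem_closedBall_zero_iff.mp (b i).2) f).tsum_sub
      (hx.summable_mul (fun i => mem_closedBall_zero_iff.mp (b' i).2) f), tsum_eq_sum (s := s)]
    · rw [map_sum]
      refine Finset.sum_congr rfl fun i hi => ?_
      simp [b, b', hi]
    · intro i hi
      simp [b, b', hi]
  rw [h1]
  calc _ = ‖((∑' i, (b i : 𝕜) * f (x i)) - f e) - ((∑' i, (b' i : 𝕜) * f (x i)) - f e)‖ := by
        rw [sub_sub_sub_cancel_right]
    _ ≤ ε / 2 * ‖f‖ + ε / 2 * ‖f‖ := (norm_sub_le _ _).trans (add_le_add (hb f) (hb' f))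
    _ = ε * ‖f‖ := by ring

end Tails

/-! ### Sign averages and unconditional convergence of polynomials -/

section Signs

variable {𝕜 : Type*} [RCLike 𝕜] {E F : Type*}
  [NormedAddCommGroup E] [NormedSpace 𝕜 E] [NormedAddCommGroup F] [NormedSpace 𝕜 F]

/-- A diagonal sum of a bilinear expression is an average over signs of the full expression, hence
is bounded by the values of the latter. -/
theorem norm_add_sum_le_of_signs {ι : Type*} (L : ι → E →L[𝕜] F) (x : ι → E) {R : ℝ}
    (s : Finset ι) (L₀ : E →L[𝕜] F) (x₀ : E)
    (h : ∀ η : ι → 𝕜, (∀ i, η i = 1 ∨ η i = -1) →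
      ‖(L₀ + ∑ i ∈ s, η i • L i) (x₀ + ∑ i ∈ s, η i • x i)‖ ≤ R) :
    ‖L₀ x₀ + ∑ i ∈ s, L i (x i)‖ ≤ R := by
  classical
  induction s using Finset.induction_on generalizing L₀ x₀ with
  | empty => simpa using h (fun _ => 1) fun _ => Or.inl rfl
  | insert j s hj ih =>
    -- The index `j` is absorbed into `L₀` and `x₀` with either sign; in the mean of the two signs
    -- the cross terms cancel and `L j (x j)` survives.
    have key : ∀ c : 𝕜, (c = 1 ∨ c = -1) →
        ‖(L₀ + c • L j) (x₀ + c • x j) + ∑ i ∈ s, L i (x i)‖ ≤ R := by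
      intro c hc
      refine ih _ _ fun η hη => ?_
      have hη' : ∀ i, Function.update η j c i = 1 ∨ Function.update η j c i = -1 := by
        intro i
        by_cases hi : i = j
        · subst hi; simpa using hc
        · simpa [hi] using hη i
      have h1 := h (Function.update η j c) hη'
      have h2 : ∀ i ∈ s, Function.update η j c i = η i := fun i hi =>
        Function.update_of_ne (ne_of_mem_of_not_mem hi hj) _ _
      rw [Finset.sum_insert hj, Finset.sum_insert hj, Function.update_self,
        Finset.sum_congr rfl fun i hi => by rw [h2 i hi],
        Finset.sum_congr (g := fun i => η i • x i) rfl fun i hi => by rw [h2 i hi],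
        ← add_assoc, ← add_assoc] at h1
      exact h1
    have h1 := key 1 (Or.inl rfl)
    have h2 := key (-1) (Or.inr rfl)
    rw [Finset.sum_insert hj]
    have h3 : (2 : 𝕜) • (L₀ x₀ + (L j (x j) + ∑ i ∈ s, L i (x i))) =
        ((L₀ + (1 : 𝕜) • L j) (x₀ + (1 : 𝕜) • x j) + ∑ i ∈ s, L i (x i)) +
        ((L₀ + (-1 : 𝕜) • L j) (x₀ + (-1 : 𝕜) • x j) + ∑ i ∈ s, L i (x i)) := by
      simp only [one_smul, neg_smul, _root_.add_apply, _root_.neg_apply,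
        map_add, map_neg, two_smul]
      abel
    have h4 := congrArg norm h3
    rw [norm_smul, RCLike.norm_ofNat] at h4
    have h5 := norm_add_le ((L₀ + (1 : 𝕜) • L j) (x₀ + (1 : 𝕜) • x j) + ∑ i ∈ s, L i (x i))
      ((L₀ + (-1 : 𝕜) • L j) (x₀ + (-1 : 𝕜) • x j) + ∑ i ∈ s, L i (x i))
    linarith

/-- Sign averaging splits off the first variable, into which a signed sum of norm at most `C` is
inserted; one degree less remains. The coefficients `a` are there so that the induction can absorb
the signs. -/
theorem norm_sum_diagonal_le {ι : Type*} (x : ι → E) (s : Finset ι) {C : ℝ}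
    (hC : ∀ a : ι → 𝕜, (∀ i, ‖a i‖ ≤ 1) → ‖∑ i ∈ s, a i • x i‖ ≤ C) (n : ℕ)
    (A : ContinuousMultilinearMap 𝕜 (fun _ : Fin (n + 1) => E) F) (a : ι → 𝕜)
    (ha : ∀ i, ‖a i‖ ≤ 1) :
    ‖∑ i ∈ s, a i • A (fun _ => x i)‖ ≤ ‖A‖ * C ^ (n + 1) := by
  have hC0 : 0 ≤ C := (norm_nonneg _).trans (hC 0 (by simp))
  have hcons : ∀ {m : ℕ} (z : E), (fun _ : Fin (m + 1) => z) = Fin.cons z fun _ : Fin m => z := by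
    intro m z
    funext i
    refine Fin.cases ?_ (fun _ => ?_) i <;> simp
  induction n generalizing a with
  | zero =>
    have h1 : ∑ i ∈ s, a i • A (fun _ => x i) = A (fun _ => ∑ i ∈ s, a i • x i) := by
      have h2 : ∀ z, A (fun _ => z) = A.curryLeft z 0 := by
        intro z
        rw [ContinuousMultilinearMap.curryLeft_apply, hcons z]
        congr
        exact Subsingleton.elim _ _
      simp only [h2, map_sum, map_smul, _root_.sum_apply,
        _root_.smul_apply]
    rw [h1]
    refine (A.le_opNorm _).trans ?_
    simp only [Finset.prod_const, Finset.card_univ, Fintype.card_fin, zero_add]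
    gcongr
    exact hC a ha
  | succ n ih =>
    let ev : ι → ContinuousMultilinearMap 𝕜 (fun _ : Fin (n + 1) => E) F →L[𝕜] F := fun i =>
      ContinuousMultilinearMap.apply 𝕜 (fun _ : Fin (n + 1) => E) F fun _ => x i
    let L : ι → E →L[𝕜] F := fun i => a i • (ev i ∘L A.curryLeft)
    have h1 : ∑ i ∈ s, a i • A (fun _ => x i) =
        (0 : E →L[𝕜] F) 0 + ∑ i ∈ s, L i (x i) := by
      simp only [_root_.zero_apply, zero_add]
      refine Finset.sum_congr rfl fun i _ => ?_
      rw [hcons (x i)]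
      rfl
    rw [h1]
    refine norm_add_sum_le_of_signs L x s 0 0 fun η hη => ?_
    have hη1 : ∀ i, ‖η i‖ ≤ 1 := fun i => by rcases hη i with h | h <;> simp [h]
    rw [zero_add, zero_add]
    set z := ∑ i ∈ s, η i • x i with hz
    have h2 : (∑ i ∈ s, η i • L i) z = ∑ i ∈ s, (η i * a i) • A.curryLeft z (fun _ => x i) := by
      simp only [_root_.sum_apply, L, ev, _root_.smul_apply, smul_smul]
      rfl
    rw [h2]
    refine (ih (A.curryLeft z) (fun i => η i * a i) fun i => ?_).trans ?_
    · rw [norm_mul]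
      exact mul_le_one₀ (hη1 i) (norm_nonneg _) (ha i)
    · have h3 : ‖A.curryLeft z‖ ≤ ‖A‖ * C := by
        refine (A.curryLeft.le_opNorm z).trans ?_
        rw [ContinuousMultilinearMap.curryLeft_norm]
        gcongr
        exact hC η hη1
      calc _ ≤ (‖A‖ * C) * C ^ (n + 1) := by gcongr
        _ = _ := by ring

/-- Every homogeneous polynomial of positive degree is unconditionally converging as soon as all
weakly unconditionally Cauchy series have weak sums. -/
theorem mem_uncondConvPoly_of_hasWeakSums [CompleteSpace F] {k : ℕ} (hk : 1 ≤ k)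
    (hE : ∀ x : ℕ → E, IsWUC 𝕜 x → HasWeakSums 𝕜 x) (P : HomPoly 𝕜 k E F) :
    P ∈ UncondConvPoly 𝕜 k E F := by
  intro x hx n hn
  obtain ⟨m, rfl⟩ := Nat.exists_eq_add_of_le' hk
  obtain ⟨A, hA⟩ := P.exists_multilinear
  suffices h : Summable fun i => P (x i) from
    ⟨_, (h.comp_injective hn.injective).hasSum.tendsto_sum_nat⟩
  rw [summable_iff_vanishing_norm]
  intro ε hε
  obtain ⟨δ, hδ, hδ1⟩ : ∃ δ : ℝ, 0 < δ ∧ ‖A‖ * δ ^ (m + 1) < ε := by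
    have h1 : Tendsto (fun δ : ℝ => ‖A‖ * δ ^ (m + 1)) (𝓝[>] 0) (𝓝 (‖A‖ * 0 ^ (m + 1))) :=
      ((continuous_const.mul (continuous_id.pow _)).tendsto 0).mono_left nhdsWithin_le_nhds
    rw [zero_pow (Nat.succ_ne_zero m), mul_zero] at h1
    exact ((eventually_mem_nhdsWithin).and (h1.eventually (gt_mem_nhds hε))).exists
  obtain ⟨M, hM⟩ := (hE x hx).exists_norm_sum_le hx hδ
  refine ⟨Finset.range M, fun t ht => ?_⟩
  have ht' : ∀ i ∈ t, M ≤ i := fun i hi => by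
    by_contra! h
    exact Finset.disjoint_left.mp ht hi (Finset.mem_range.mpr h)
  have h2 := norm_sum_diagonal_le x t (hM t ht') m A (fun _ => 1) (by simp)
  simp only [one_smul, ← hA] at h2
  exact h2.trans_lt hδ1

end Signs

/-! ### Consequences and criteria of weak compactness -/

section WeaklyCompact

variable {𝕜 : Type*} [RCLike 𝕜] {E F : Type*}
  [NormedAddCommGroup E] [NormedSpace 𝕜 E] [NormedAddCommGroup F] [NormedSpace 𝕜 F]

theorem continuous_weakSpace_eval (f : StrongDual 𝕜 E) :
    Continuous fun w : WeakSpace 𝕜 E => f ((toWeakSpace 𝕜 E).symm w) :=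
  WeakBilin.eval_continuous (topDualPairing 𝕜 E).flip f

theorem exists_norm_le_of_weakly_bounded {ι : Type*} {y : ι → E}
    (h : ∀ f : StrongDual 𝕜 E, ∃ C, ∀ i, ‖f (y i)‖ ≤ C) : ∃ C, ∀ i, ‖y i‖ ≤ C := by
  obtain ⟨C, hC⟩ := banach_steinhaus (g := fun i => NormedSpace.inclusionInDoubleDual 𝕜 E (y i)) h
  refine ⟨C, fun i => ?_⟩
  rw [← (NormedSpace.inclusionInDoubleDualLi (E := E) 𝕜).norm_map (y i)]
  exact hC i

theorem IsWUC.exists_norm_sum_range_le {x : ℕ → E} (hx : IsWUC 𝕜 x) {a : ℕ → 𝕜}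
    (ha : ∀ i, ‖a i‖ ≤ 1) : ∃ C, ∀ N, ‖∑ i ∈ Finset.range N, a i • x i‖ ≤ C := by
  refine exists_norm_le_of_weakly_bounded (𝕜 := 𝕜) fun f => ⟨∑' i, ‖f (x i)‖, fun N => ?_⟩
  rw [map_sum]
  refine (norm_sum_le _ _).trans ((Finset.sum_le_sum fun i _ => ?_).trans
    ((hx f).sum_le_tsum (Finset.range N) fun _ _ => norm_nonneg _))
  rw [map_smul, norm_smul]
  exact mul_le_of_le_one_left (norm_nonneg _) (ha i)

theorem IsWUC.exists_norm_le {x : ℕ → E} (hx : IsWUC 𝕜 x) : ∃ C, ∀ i, ‖x i‖ ≤ C :=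
  exists_norm_le_of_weakly_bounded (𝕜 := 𝕜) fun f =>
    ⟨∑' i, ‖f (x i)‖, fun i => (hx f).le_tsum i fun _ _ => norm_nonneg _⟩

/-- The homogeneous polynomial `x ↦ φ x ^ n • x`. -/
def powSMul (φ : StrongDual 𝕜 E) (n : ℕ) : HomPoly 𝕜 (n + 1) E E :=
  HomPoly.ofMultilinear (ContinuousLinearMap.uncurryLeft
    (ContinuousMultilinearMap.smulRightL 𝕜 (fun _ : Fin n => E) E
      ((ContinuousMultilinearMap.mkPiAlgebra 𝕜 (Fin n) 𝕜).compContinuousLinearMap fun _ => φ)))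

theorem powSMul_apply (φ : StrongDual 𝕜 E) (n : ℕ) (x : E) : powSMul φ n x = φ x ^ n • x := by
  simp [powSMul, Fin.tail]

/-- One factor `φ (x i)` is absolutely summable and all the others are bounded. The exponent `n + 1`
guarantees such a factor, hence the restriction to degree at least two. -/
theorem powSMul_mem_uncondConvPoly [CompleteSpace E] (φ : StrongDual 𝕜 E) (n : ℕ) :
    powSMul φ (n + 1) ∈ UncondConvPoly 𝕜 (n + 1 + 1) E E := by
  intro x hx m hm
  obtain ⟨C, hC⟩ := hx.exists_norm_le
  have hC0 : 0 ≤ C := (norm_nonneg _).trans (hC 0)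
  suffices h : Summable fun i => powSMul φ (n + 1) (x i) from
    ⟨_, (h.comp_injective hm.injective).hasSum.tendsto_sum_nat⟩
  refine Summable.of_norm_bounded ((hx φ).mul_left ((‖φ‖ * C) ^ n * C)) fun i => ?_
  rw [powSMul_apply, norm_smul, norm_pow, pow_succ]
  have h1 : ‖φ (x i)‖ ≤ ‖φ‖ * C := (φ.le_opNorm _).trans (by gcongr; exact hC i)
  calc ‖φ (x i)‖ ^ n * ‖φ (x i)‖ * ‖x i‖ ≤ (‖φ‖ * C) ^ n * ‖φ (x i)‖ * C := by
        gcongr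
        exact hC i
    _ = _ := by ring

/-- If the polynomial `x ↦ φ x ^ n • x` is weakly compact for some `φ ≠ 0`, then the weakly
unconditionally Cauchy series have weak sums. -/
theorem hasWeakSums_of_powSMul_mem {φ : StrongDual 𝕜 E} {e : E} (he : φ e = 1) {n : ℕ}
    (h : powSMul φ n ∈ WeaklyCompactPoly 𝕜 (n + 1) E E) {x : ℕ → E} (hx : IsWUC 𝕜 x) :
    HasWeakSums 𝕜 x := by
  intro a ha
  obtain ⟨C, hC⟩ := hx.exists_norm_sum_range_le ha
  let s : ℕ → E := fun N => ∑ i ∈ Finset.range N, a i • x i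
  -- The partial sums are shifted along `e` into the hyperplane `φ = 1`, where the polynomial is the
  -- identity. A weak cluster point of `y` then yields the weak sum once the shift is undone.
  let y : ℕ → E := fun N => s N - φ (s N) • e + e
  have hfs : ∀ f : StrongDual 𝕜 E, Tendsto (fun N => f (s N)) atTop (𝓝 (∑' i, a i * f (x i))) := by
    intro f
    have := (hx.summable_mul ha f).hasSum.tendsto_sum_nat
    simpa [s] using this
  have hy : ∀ N, powSMul φ n (y N) = y N := by
    intro N
    have : φ (y N) = 1 := by simp [y, he]
    rw [powSMul_apply, this, one_pow, one_smul]
  have hbd : Bornology.IsBounded (Set.range y) := by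
    refine isBounded_iff_forall_norm_le.mpr ⟨C + ‖φ‖ * C * ‖e‖ + ‖e‖, ?_⟩
    rintro _ ⟨N, rfl⟩
    refine (norm_add_le _ _).trans (add_le_add_left ((norm_sub_le _ _).trans ?_) _)
    rw [norm_smul]
    gcongr
    · exact hC N
    · exact (φ.le_opNorm _).trans (by gcongr; exact hC N)
  have hK := h _ hbd
  let U : Ultrafilter ℕ := Ultrafilter.of atTop
  have hU : (U : Filter ℕ) ≤ atTop := Ultrafilter.of_le _
  obtain ⟨w, -, hw⟩ := hK.ultrafilter_le_nhds (U.map fun N => toWeakSpace 𝕜 E (y N)) (by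
    rw [le_principal_iff]
    refine Filter.mem_map.mpr (Filter.univ_mem' fun N => subset_closure ?_)
    exact ⟨y N, ⟨y N, ⟨N, rfl⟩, hy N⟩, rfl⟩)
  have hw' : Tendsto (fun N => toWeakSpace 𝕜 E (y N)) U (𝓝 w) := hw
  refine ⟨(toWeakSpace 𝕜 E).symm w - e + (∑' i, a i * φ (x i)) • e, fun f => ?_⟩
  have h1 : Tendsto (fun N => f (y N)) U (𝓝 (f ((toWeakSpace 𝕜 E).symm w))) :=
    ((continuous_weakSpace_eval f).tendsto w).comp hw'
  have h2 : Tendsto (fun N => f (y N)) U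
      (𝓝 ((∑' i, a i * f (x i)) - (∑' i, a i * φ (x i)) * f e + f e)) := by
    have := (((hfs f).sub ((hfs φ).mul_const (f e))).add_const (f e)).mono_left hU
    simpa [y] using this
  have h3 := tendsto_nhds_unique h1 h2
  simp [h3]

theorem hasWeakSums_of_uncondConvPoly_subset [CompleteSpace E] {k : ℕ} (hk : 1 < k)
    (h : UncondConvPoly 𝕜 k E E ⊆ WeaklyCompactPoly 𝕜 k E E) (x : ℕ → E) (hx : IsWUC 𝕜 x) :
    HasWeakSums 𝕜 x := by
  rcases subsingleton_or_nontrivial E with hE | hE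
  · refine fun a _ => ⟨0, fun f => ?_⟩
    simp [Subsingleton.elim (x _) 0]
  obtain ⟨e, he⟩ := exists_ne (0 : E)
  obtain ⟨φ, hφ, -⟩ := exists_dual_eq_one_of_notMem (𝕜 := 𝕜) (p := ⊥) (x := e)
    (by simp) (by simpa using he)
  obtain ⟨n, rfl⟩ := Nat.exists_eq_add_of_lt hk
  obtain ⟨m, hm⟩ : ∃ m, 1 + n + 1 = m + 1 + 1 := ⟨n, by omega⟩
  rw [hm] at h
  exact hasWeakSums_of_powSMul_mem hφ (h (powSMul_mem_uncondConvPoly φ m)) hx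

/-- If the space of
scalar-valued `k`-homogeneous polynomials is reflexive, then every vector-valued
`k`-homogeneous polynomial is weakly compact. -/
theorem mem_weaklyCompactPoly_of_isReflexive [CompleteSpace F] {k : ℕ}
    (h : IsReflexive 𝕜 (HomPoly 𝕜 k E 𝕜)) (P : HomPoly 𝕜 k E F) :
    P ∈ WeaklyCompactPoly 𝕜 k E F := by
  intro S hS
  obtain ⟨A, hA⟩ := P.exists_multilinear
  let pull : StrongDual 𝕜 F →L[𝕜] HomPoly 𝕜 k E 𝕜 := LinearMap.mkContinuous
    { toFun := fun g => HomPoly.ofMultilinear (g.compContinuousMultilinearMap A)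
      map_add' := fun _ _ => rfl
      map_smul' := fun _ _ => rfl } ‖A‖ fun g => by
        refine (HomPoly.norm_ofMultilinear_le _).trans ?_
        rw [mul_comm]
        exact g.norm_compContinuousMultilinearMap_le A
  have hpull : ∀ g x, pull g x = g (P x) := fun g x => by rw [hA]; rfl
  let J := NormedSpace.inclusionInDoubleDual 𝕜 F
  let T : StrongDual 𝕜 (HomPoly 𝕜 k E 𝕜) →L[𝕜] StrongDual 𝕜 (StrongDual 𝕜 F) :=
    (ContinuousLinearMap.compL 𝕜 (StrongDual 𝕜 F) (HomPoly 𝕜 k E 𝕜) 𝕜).flip pull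
  have hT : ∀ ξ g, T ξ g = ξ (pull g) := fun _ _ => rfl
  have hTδ : ∀ x, T (HomPoly.evalPoly 𝕜 k E x) = J (P x) := by
    intro x
    ext g
    rw [hT, HomPoly.evalPoly_apply, hpull]
    rfl
  have hclosed : IsClosed (J.range : Set (StrongDual 𝕜 (StrongDual 𝕜 F))) := by
    rw [LinearMap.coe_range]
    exact (NormedSpace.inclusionInDoubleDualLi (E := F)
      𝕜).isometry.isUniformInducing.isComplete_range.isClosed
  have hrange : ∀ ξ, ∃ w, J w = T ξ := by
    intro ξ
    by_contra hξ
    -- `Ψ` vanishes on `F`, so the polynomial `Q` representing `Ψ ∘ T` vanishes at every point of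
    -- `E`.
    obtain ⟨Ψ, hΨ1, hΨ0⟩ := exists_dual_eq_one_of_notMem (𝕜 := 𝕜) hclosed (x := T ξ) fun h => hξ h
    obtain ⟨Q, hQ⟩ := h (Ψ ∘L T)
    have hQ' : ∀ η, Ψ (T η) = η Q := fun η => (DFunLike.congr_fun hQ η).symm
    have hQ0 : Q = 0 := DFunLike.ext _ _ fun x => by
      rw [← HomPoly.evalPoly_apply, ← hQ', hTδ]
      exact hΨ0 _ ⟨P x, rfl⟩
    rw [hQ', hQ0, map_zero] at hΨ1
    exact zero_ne_one hΨ1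
  choose T' hT' using hrange
  have hT'g : ∀ ξ (g : StrongDual 𝕜 F), g (T' ξ) = ξ (pull g) := fun ξ g => by
    rw [← hT, ← hT']
    rfl
  obtain ⟨R, hR⟩ := ((Metric.isBounded_iff_subset_closedBall (0 : E)).mp hS)
  let B : Set (WeakDual 𝕜 (HomPoly 𝕜 k E 𝕜)) :=
    WeakDual.toStrongDual ⁻¹' Metric.closedBall 0 (‖HomPoly.evalPoly 𝕜 k E‖ * R ^ k)
  have hB : IsCompact B := WeakDual.isCompact_closedBall _ _
  let τ : WeakDual 𝕜 (HomPoly 𝕜 k E 𝕜) → WeakSpace 𝕜 F := fun ξ =>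
    toWeakSpace 𝕜 F (T' (WeakDual.toStrongDual ξ))
  have hτ : Continuous τ := by
    refine WeakBilin.continuous_of_continuous_eval _ fun g => ?_
    have : (fun ξ => (topDualPairing 𝕜 F).flip (τ ξ) g) = fun ξ => ξ (pull g) :=
      funext fun ξ => hT'g _ g
    rw [this]
    exact WeakDual.eval_continuous _
  refine (hB.image hτ).closure_of_subset ?_
  rintro _ ⟨_, ⟨x, hx, rfl⟩, rfl⟩
  refine ⟨StrongDual.toWeakDual (HomPoly.evalPoly 𝕜 k E x), ?_, ?_⟩
  · refine mem_closedBall_zero_iff.mpr ?_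
    change ‖HomPoly.evalPoly 𝕜 k E x‖ ≤ _
    refine (HomPoly.norm_apply_le_pow _ x).trans ?_
    gcongr
    exact mem_closedBall_zero_iff.mp (hR hx)
  · refine congrArg (toWeakSpace 𝕜 F) ?_
    refine (NormedSpace.inclusionInDoubleDualLi (E := F) 𝕜).injective ?_
    exact (hT' _).trans (hTδ x)

end WeaklyCompact

/-! ### Weakly compact norming sets span a dense subspace -/

section Predual

variable {𝕜 : Type*} [RCLike 𝕜] {Y : Type*} [NormedAddCommGroup Y] [NormedSpace 𝕜 Y]

/-- A functional at distance at least `θ` from the span of finitely many others is at least `θ / 2`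
at some point of the unit ball where the others vanish. -/
theorem exists_forall_eq_zero_and_le_re (G : Finset (StrongDual 𝕜 Y)) (ξ : StrongDual 𝕜 Y) {θ : ℝ}
    (hθ : 0 < θ) (hξ : ∀ η ∈ Submodule.span 𝕜 (G : Set (StrongDual 𝕜 Y)), θ ≤ ‖ξ - η‖) :
    ∃ Q : Y, ‖Q‖ ≤ 1 ∧ (∀ d ∈ G, d Q = 0) ∧ θ / 2 ≤ RCLike.re (ξ Q) := by
  by_contra! hcon
  let p : Submodule 𝕜 Y := ⨅ d : G, LinearMap.ker (d : StrongDual 𝕜 Y).toLinearMap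
  have hp : ∀ q ∈ p, ∀ d ∈ G, d q = 0 := fun q hq d hd => by
    have := (Submodule.mem_iInf _).mp hq ⟨d, hd⟩
    exact this
  have hbound : ∀ q ∈ p, ‖ξ q‖ ≤ θ / 2 * ‖q‖ := by
    intro q hq
    by_cases hq0 : q = 0
    · simp [hq0]
    have hqn : 0 < ‖q‖ := norm_pos_iff.mpr hq0
    obtain ⟨c, hc, hcq⟩ := RCLike.exists_norm_eq_mul_self (ξ q)
    have h1 := hcon (((‖q‖⁻¹ : ℝ) : 𝕜) • c • q) (by
      rw [norm_smul, norm_smul, hc, one_mul, RCLike.norm_ofReal, abs_of_pos (inv_pos.mpr hqn),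
        inv_mul_cancel₀ hqn.ne']) fun d hd => by simp [hp q hq d hd]
    have h2 : ξ (((‖q‖⁻¹ : ℝ) : 𝕜) • c • q) = ((‖q‖⁻¹ * ‖ξ q‖ : ℝ) : 𝕜) := by
      rw [ξ.map_smul, ξ.map_smul, smul_eq_mul, smul_eq_mul, ← hcq, ← RCLike.ofReal_mul]
    rw [h2, RCLike.ofReal_re, inv_mul_lt_iff₀ hqn] at h1
    linarith
  -- On the common kernel `ξ` has norm at most `θ / 2`. For a Hahn–Banach extension `g`, the
  -- difference `ξ - g` vanishes there, so it lies in the span, at distance less than `θ` from `ξ`.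
  obtain ⟨g, hg, hgn⟩ := exists_extension_norm_eq p (ξ ∘L p.subtypeL)
  have hg1 : ‖g‖ ≤ θ / 2 := by
    rw [hgn]
    exact ContinuousLinearMap.opNorm_le_bound _ (by positivity) fun q => hbound q q.2
  have hmem : (ξ - g).toLinearMap ∈
      Submodule.span 𝕜 (Set.range fun d : G => (d : StrongDual 𝕜 Y).toLinearMap) := by
    refine mem_span_of_iInf_ker_le_ker fun q hq => ?_
    have h1 := hg ⟨q, hq⟩
    have h2 : ξ q = g q := h1.symm
    simp [h2]
  obtain ⟨c, hc⟩ := (Submodule.mem_span_range_iff_exists_fun 𝕜).mp hmem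
  have h3 : ξ - g = ∑ d : G, c d • (d : StrongDual 𝕜 Y) := by
    ext q
    have := (DFunLike.congr_fun hc q).symm
    simpa using this
  have h4 := hξ (ξ - g) (by
    rw [h3]
    exact Submodule.sum_mem _ fun d _ => Submodule.smul_mem _ _ (Submodule.subset_span d.2))
  rw [sub_sub_cancel] at h4
  linarith

/-- The hull of a finite set is norm compact, so finitely many functionals from `Δ` suffice for its
part in `A`. -/
theorem exists_finset_forall_exists_lt_re [NormedSpace ℝ Y] {Δ : Set (StrongDual 𝕜 Y)}
    (hΔ : ∀ Q : Y, ∀ r < ‖Q‖, ∃ d ∈ Δ, r < RCLike.re (d Q)) (s : Finset Y) {A : Set Y}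
    (hA : IsClosed A) {c : ℝ} (hc : ∀ Q ∈ A, c < ‖Q‖) :
    ∃ D : Finset (StrongDual 𝕜 Y), (D : Set (StrongDual 𝕜 Y)) ⊆ Δ ∧
      ∀ Q ∈ convexHull ℝ (s : Set Y), Q ∈ A → ∃ d ∈ D, c < RCLike.re (d Q) := by
  have hcpt : IsCompact (convexHull ℝ (s : Set Y) ∩ A) :=
    (s.finite_toSet.isCompact_convexHull (𝕜 := ℝ)).inter_right hA
  obtain ⟨b, hbΔ, hbf, hb⟩ := hcpt.elim_finite_subcover_image (b := Δ)
    (c := fun d => {Q | c < RCLike.re (d Q)})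
    (fun d _ => isOpen_lt continuous_const (RCLike.continuous_re.comp d.continuous))
    (fun Q hQ => by
      obtain ⟨d, hd, hdQ⟩ := hΔ Q c (hc Q hQ.2)
      exact Set.mem_biUnion hd hdQ)
  refine ⟨hbf.toFinset, by simpa using hbΔ, fun Q hQ hQA => ?_⟩
  obtain ⟨d, hd, hdQ⟩ := Set.mem_iUnion₂.mp (hb ⟨hQ, hQA⟩)
  exact ⟨d, hbf.mem_toFinset.mpr hd, hdQ⟩

/-- The bookkeeping for a mutual recursion: `q` picks a new vector from the functionals used so far,
and `N` picks new functionals from the vectors used so far. -/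
theorem exists_seq_finset_finset {α β : Type*} [DecidableEq α] [DecidableEq β]
    (q : Finset α → β) (N : Finset β → Finset α) :
    ∃ (G : ℕ → Finset α) (s : ℕ → Finset β), G 0 = ∅ ∧
      (∀ n, G (n + 1) = G n ∪ N (s (n + 1))) ∧ ∀ n, s (n + 1) = insert (q (G n)) (s n) := by
  let S : ℕ → Finset α × Finset β := fun n => (fun S : Finset α × Finset β =>
    (S.1 ∪ N (insert (q S.1) S.2), insert (q S.1) S.2))^[n] (∅, ∅)
  have hS : ∀ n, S (n + 1) =
      ((S n).1 ∪ N (insert (q (S n).1) (S n).2), insert (q (S n).1) (S n).2) :=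
    fun n => Function.iterate_succ_apply' _ n _
  refine ⟨fun n => (S n).1, fun n => (S n).2, rfl, fun n => ?_, fun n => ?_⟩ <;> simp only [hS]

/-- If `ξ` is not in the closed span of `Δ`, there is a bounded sequence of vectors vanishing
eventually at each point of a subset `D` of `Δ`, all of whose convex combinations are large at some
point of `D`. -/
theorem exists_seq_of_notMem_closure_span [NormedSpace ℝ Y] [IsScalarTower ℝ 𝕜 Y]
    {Δ : Set (StrongDual 𝕜 Y)}
    (hΔ : ∀ Q : Y, ∀ r < ‖Q‖, ∃ d ∈ Δ, r < RCLike.re (d Q)) {ξ : StrongDual 𝕜 Y}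
    (hξ : ξ ∉ (Submodule.span 𝕜 Δ).topologicalClosure) :
    ∃ (Q : ℕ → Y) (D : Set (StrongDual 𝕜 Y)) (c : ℝ), 0 < c ∧ D ⊆ Δ ∧ (∀ n, ‖Q n‖ ≤ 1) ∧
      (∀ d ∈ D, ∀ᶠ n in atTop, d (Q n) = 0) ∧
      ∀ q ∈ convexHull ℝ (Set.range Q), ∃ d ∈ D, c < RCLike.re (d q) := by
  classical
  set θ := Metric.infDist ξ (Submodule.span 𝕜 Δ : Set (StrongDual 𝕜 Y)) with hθdef
  have hne : (Submodule.span 𝕜 Δ : Set (StrongDual 𝕜 Y)).Nonempty := ⟨0, Submodule.zero_mem _⟩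
  have hθ : 0 < θ := by
    refine lt_of_le_of_ne Metric.infDist_nonneg fun h => hξ ?_
    exact (Metric.mem_closure_iff_infDist_zero hne).mpr h.symm
  have hθle : ∀ η ∈ Submodule.span 𝕜 Δ, θ ≤ ‖ξ - η‖ := fun η hη => by
    rw [← dist_eq_norm]
    exact Metric.infDist_le_dist_of_mem hη
  set A : Set Y := {q | θ / 2 ≤ RCLike.re (ξ q)} with hA
  have hAc : IsClosed A :=
    isClosed_le continuous_const (RCLike.continuous_re.comp ξ.continuous)
  have hAconv : Convex ℝ A := by
    intro q hq q' hq' a b ha hb hab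
    simp only [hA, Set.mem_ofPred_eq] at hq hq' ⊢
    have h1 : ∀ (a : ℝ) (q : Y), RCLike.re (ξ (a • q)) = a * RCLike.re (ξ q) := by
      intro a q
      rw [← algebraMap_smul 𝕜 a q, map_smul, RCLike.algebraMap_eq_ofReal, smul_eq_mul,
        RCLike.re_ofReal_mul]
    rw [map_add, map_add, h1, h1]
    calc θ / 2 = a * (θ / 2) + b * (θ / 2) := by rw [← add_mul, hab, one_mul]
      _ ≤ _ := by gcongr
  -- Points of `A` have norm at least `2 * c`; the last halving makes the inequality strict, and the
  -- `+ 1` keeps the denominator positive.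
  set c : ℝ := θ / 2 / (‖ξ‖ + 1) / 2 with hc
  have hξ1 : 0 < ‖ξ‖ + 1 := by positivity
  have hc0 : 0 < c := by positivity
  have hcA : ∀ q ∈ A, c < ‖q‖ := by
    intro q hq
    have h1 : θ / 2 ≤ ‖ξ‖ * ‖q‖ := (hq.trans (RCLike.re_le_norm _)).trans (ξ.le_opNorm q)
    have h2 : θ / 2 / (‖ξ‖ + 1) ≤ ‖q‖ := by
      rw [div_le_iff₀ hξ1]
      linarith [norm_nonneg q]
    have h3 : 0 < θ / 2 / (‖ξ‖ + 1) := by positivity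
    linarith
  -- The inclusion in `Δ` sits inside the existential so that `q` is defined on all finite sets, as
  -- the recursion requires; outside `Δ` the value is a dummy `0`.
  have hq : ∀ G : Finset (StrongDual 𝕜 Y), ∃ q : Y, (G : Set (StrongDual 𝕜 Y)) ⊆ Δ →
      ‖q‖ ≤ 1 ∧ (∀ d ∈ G, d q = 0) ∧ q ∈ A := by
    intro G
    by_cases hG : (G : Set (StrongDual 𝕜 Y)) ⊆ Δ
    · obtain ⟨q, hq⟩ := exists_forall_eq_zero_and_le_re G ξ hθ fun η hη =>
        hθle η (Submodule.span_mono hG hη)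
      exact ⟨q, fun _ => hq⟩
    · exact ⟨0, fun h => absurd h hG⟩
  choose q hq using hq
  choose N hNΔ hN using fun s : Finset Y => exists_finset_forall_exists_lt_re hΔ s hAc hcA
  obtain ⟨G, s, hG0, hG, hs⟩ := exists_seq_finset_finset q N
  have hGΔ : ∀ n, (G n : Set (StrongDual 𝕜 Y)) ⊆ Δ := by
    intro n
    induction n with
    | zero => simp [hG0]
    | succ n ih =>
      rw [hG, Finset.coe_union]
      exact Set.union_subset ih (hNΔ _)
  have hGmono : Monotone G := monotone_nat_of_le_succ fun n => by
    rw [hG]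
    exact Finset.subset_union_left
  have hsmono : Monotone s := monotone_nat_of_le_succ fun n => by
    rw [hs]
    exact Finset.subset_insert _ _
  refine ⟨fun n => q (G n), ⋃ n, (G n : Set (StrongDual 𝕜 Y)), c, hc0,
    Set.iUnion_subset hGΔ, fun n => (hq _ (hGΔ n)).1, fun d hd => ?_, fun g hg => ?_⟩
  · obtain ⟨n, hn⟩ := Set.mem_iUnion.mp hd
    filter_upwards [eventually_ge_atTop n] with m hm
    exact (hq _ (hGΔ m)).2.1 d (hGmono hm hn)
  · have hgA : g ∈ A := by
      refine convexHull_min ?_ hAconv hg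
      rintro _ ⟨n, rfl⟩
      exact (hq _ (hGΔ n)).2.2
    have hgS : g ∈ ⋃ n, convexHull ℝ (s (n + 1) : Set Y) := by
      have hmono : Monotone fun n => convexHull ℝ (s (n + 1) : Set Y) := fun m n hmn =>
        convexHull_mono (Finset.coe_subset.mpr (hsmono (Nat.succ_le_succ hmn)))
      refine convexHull_min ?_
        (hmono.directed_le.convex_iUnion fun n => convex_convexHull ℝ _) hg
      rintro _ ⟨n, rfl⟩
      refine Set.mem_iUnion.mpr ⟨n, subset_convexHull ℝ _ ?_⟩
      rw [hs]
      exact Finset.mem_insert_self _ _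
    obtain ⟨n, hn⟩ := Set.mem_iUnion.mp hgS
    obtain ⟨d, hd, hdg⟩ := hN _ g hn hgA
    refine ⟨d, Set.mem_iUnion.mpr ⟨n + 1, ?_⟩, hdg⟩
    rw [hG]
    exact Finset.mem_union_right _ hd

/-- If a weakly relatively compact set of functionals determines the norm of `Y`, then it spans a
dense subspace of the dual of `Y`. -/
theorem mem_closure_span_of_isCompact_closure {Δ : Set (StrongDual 𝕜 Y)}
    (hK : IsCompact (closure (toWeakSpace 𝕜 (StrongDual 𝕜 Y) '' Δ)))
    (hΔ1 : ∀ d ∈ Δ, ‖d‖ ≤ 1)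
    (hΔ : ∀ Q : Y, ∀ r < ‖Q‖, ∃ d ∈ Δ, r < RCLike.re (d Q)) (ξ : StrongDual 𝕜 Y) :
    ξ ∈ (Submodule.span 𝕜 Δ).topologicalClosure := by
  by_contra hξ
  let _ : NormedSpace ℝ Y := NormedSpace.restrictScalars ℝ 𝕜 Y
  have _ : IsScalarTower ℝ 𝕜 Y := RestrictScalars.isScalarTower ℝ 𝕜 Y
  obtain ⟨Q, D, c, hc, hDΔ, hQ1, hQD, hQc⟩ := exists_seq_of_notMem_closure_span hΔ hξ
  -- The closure of `D` and not of `Δ`: only on `D` are the `Q n` known to vanish eventually.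
  set K : Set (WeakSpace 𝕜 (StrongDual 𝕜 Y)) :=
    closure (toWeakSpace 𝕜 (StrongDual 𝕜 Y) '' D) with hKdef
  have hKc : IsCompact K := hK.of_isClosed_subset isClosed_closure
    (closure_mono (Set.image_mono hDΔ))
  have : CompactSpace K := isCompact_iff_compactSpace.mp hKc
  let v : K → StrongDual 𝕜 Y := fun κ => (toWeakSpace 𝕜 (StrongDual 𝕜 Y)).symm κ
  have hev : ∀ q : Y, Continuous fun w : WeakSpace 𝕜 (StrongDual 𝕜 Y) =>
      ((toWeakSpace 𝕜 (StrongDual 𝕜 Y)).symm w) q := fun q =>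
    continuous_weakSpace_eval (NormedSpace.inclusionInDoubleDual 𝕜 Y q)
  have hvspan : ∀ κ : K, v κ ∈ (Submodule.span 𝕜 D).topologicalClosure := by
    intro κ
    by_contra hκ
    obtain ⟨Ψ, hΨ1, hΨ0⟩ := exists_dual_eq_one_of_notMem
      (Submodule.isClosed_topologicalClosure _) hκ
    have hcl : K ⊆ {w | Ψ ((toWeakSpace 𝕜 (StrongDual 𝕜 Y)).symm w) = 0} := by
      refine closure_minimal ?_ (isClosed_eq (continuous_weakSpace_eval Ψ) continuous_const)
      rintro _ ⟨d, hd, rfl⟩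
      exact hΨ0 _ (Submodule.le_topologicalClosure _ (Submodule.subset_span hd))
    have h1 : Ψ (v κ) = 0 := hcl κ.2
    rw [hΨ1] at h1
    exact one_ne_zero h1
  have hspan0 : ∀ η ∈ Submodule.span 𝕜 D, ∀ᶠ n in atTop, η (Q n) = 0 := by
    intro η hη
    induction hη using Submodule.span_induction with
    | mem d hd => exact hQD d hd
    | zero => simp
    | add η η' _ _ h h' => filter_upwards [h, h'] with n hn hn'; simp [hn, hn']
    | smul a η _ h => filter_upwards [h] with n hn; simp [hn]
  -- Points of `K` lie in the norm closure of the span of `D`, by Hahn–Banach; since the `Q n` are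
  -- bounded, their eventual vanishing on the span gives convergence to zero on this closure.
  have hlim : ∀ κ : K, Tendsto (fun n => RCLike.re (v κ (Q n))) atTop (𝓝 0) := by
    intro κ
    rw [Metric.tendsto_atTop]
    intro ε hε
    obtain ⟨η, hη, hκη⟩ := Metric.mem_closure_iff.mp (hvspan κ) ε hε
    obtain ⟨N, hN⟩ := eventually_atTop.mp (hspan0 η hη)
    refine ⟨N, fun n hn => ?_⟩
    rw [Real.dist_eq, sub_zero]
    refine (RCLike.abs_re_le_norm _).trans_lt (lt_of_le_of_lt ?_ hκη)
    rw [dist_eq_norm]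
    have h1 : v κ (Q n) = (v κ - η) (Q n) := by simp [hN n hn]
    rw [h1]
    refine ((v κ - η).le_opNorm _).trans (mul_le_of_le_one_right (norm_nonneg _) (hQ1 n))
  have hbd : ∀ n, ∀ κ : K, ‖v κ (Q n)‖ ≤ 1 := by
    intro n κ
    have hcl : K ⊆ {w | ‖((toWeakSpace 𝕜 (StrongDual 𝕜 Y)).symm w) (Q n)‖ ≤ 1} := by
      refine closure_minimal ?_ (isClosed_le (hev _).norm continuous_const)
      rintro _ ⟨d, hd, rfl⟩
      exact (d.le_opNorm _).trans
        (mul_le_one₀ (hΔ1 d (hDΔ hd)) (norm_nonneg _) (hQ1 n))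
    exact hcl κ.2
  let Φ : Y →ₗ[ℝ] C(K, ℝ) :=
    { toFun := fun q => ⟨fun κ => RCLike.re (v κ q),
        RCLike.continuous_re.comp ((hev q).comp continuous_subtype_val)⟩
      map_add' := fun q q' => by ext κ; simp
      map_smul' := fun a q => by
        ext κ
        change RCLike.re (v κ (a • q)) = a * RCLike.re (v κ q)
        rw [← algebraMap_smul 𝕜 a q, map_smul, RCLike.algebraMap_eq_ofReal, smul_eq_mul,
          RCLike.re_ofReal_mul] }
  obtain ⟨g, hg, hgc⟩ := exists_mem_convexHull_forall_lt (f := fun n => Φ (Q n)) (M := 1)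
    (fun n => (ContinuousMap.norm_le _ zero_le_one).mpr fun κ =>
      (RCLike.abs_re_le_norm _).trans (hbd n κ)) hlim hc
  have hrange : (Set.range fun n => Φ (Q n)) = Φ '' Set.range Q := by
    rw [← Set.range_comp]
    rfl
  rw [hrange, ← LinearMap.image_convexHull] at hg
  obtain ⟨q, hq, rfl⟩ := hg
  obtain ⟨d, hd, hdq⟩ := hQc q hq
  exact absurd (hgc ⟨toWeakSpace 𝕜 _ d, subset_closure ⟨d, hd, rfl⟩⟩) (not_lt.mpr hdq.le)

end Predual

/-! ### Reflexivity of the space of scalar polynomials -/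

section Reflexive

variable {𝕜 : Type*} [RCLike 𝕜] {k : ℕ} {E : Type*} [NormedAddCommGroup E] [NormedSpace 𝕜 E]

/-- The space of scalar polynomials is reflexive if evaluation is a weakly compact polynomial. -/
theorem isReflexive_of_evalPoly_mem
    (h : HomPoly.evalPoly 𝕜 k E ∈ WeaklyCompactPoly 𝕜 k E (StrongDual 𝕜 (HomPoly 𝕜 k E 𝕜))) :
    IsReflexive 𝕜 (HomPoly 𝕜 k E 𝕜) := by
  let δ := HomPoly.evalPoly 𝕜 k E
  -- Scalars from the unit disc are included so that real parts alone recover the norm of a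
  -- polynomial; multiplying by this compact disc preserves weak compactness.
  let Δ : Set (StrongDual 𝕜 (HomPoly 𝕜 k E 𝕜)) :=
    {d | ∃ (c : 𝕜) (x : E), ‖c‖ ≤ 1 ∧ ‖x‖ ≤ 1 ∧ d = c • δ x}
  have hK : IsCompact (closure (toWeakSpace 𝕜 (StrongDual 𝕜 (HomPoly 𝕜 k E 𝕜)) '' Δ)) := by
    have h1 := h (Metric.closedBall 0 1) Metric.isBounded_closedBall
    have h2 := ((isCompact_closedBall (0 : 𝕜) 1).prod h1).image
      (continuous_smul (M := 𝕜) (X := WeakSpace 𝕜 (StrongDual 𝕜 (HomPoly 𝕜 k E 𝕜))))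
    refine h2.closure_of_subset ?_
    rintro _ ⟨_, ⟨c, x, hc, hx, rfl⟩, rfl⟩
    exact ⟨(c, toWeakSpace 𝕜 _ (δ x)), ⟨mem_closedBall_zero_iff.mpr hc,
      subset_closure ⟨_, ⟨x, mem_closedBall_zero_iff.mpr hx, rfl⟩, rfl⟩⟩, rfl⟩
  have hΔ1 : ∀ d ∈ Δ, ‖d‖ ≤ 1 := by
    rintro _ ⟨c, x, hc, hx, rfl⟩
    rw [norm_smul]
    exact mul_le_one₀ hc (norm_nonneg _) (HomPoly.norm_evalPoly_le hx)
  have hΔ : ∀ Q : HomPoly 𝕜 k E 𝕜, ∀ r < ‖Q‖, ∃ d ∈ Δ, r < RCLike.re (d Q) := by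
    intro Q r hr
    have : Nonempty (Metric.closedBall (0 : E) 1) := ⟨⟨0, by simp⟩⟩
    obtain ⟨⟨x, hx⟩, hrx⟩ := exists_lt_of_lt_ciSup hr
    obtain ⟨c, hc, hcx⟩ := RCLike.exists_norm_eq_mul_self (Q x)
    refine ⟨c • δ x, ⟨c, x, hc.le, mem_closedBall_zero_iff.mp hx, rfl⟩, ?_⟩
    rw [_root_.smul_apply, HomPoly.evalPoly_apply, smul_eq_mul, ← hcx, RCLike.ofReal_re]
    exact hrx
  have hdense := mem_closure_span_of_isCompact_closure hK hΔ1 hΔ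
  intro Φ
  obtain ⟨A, hA⟩ := δ.exists_multilinear
  let Q : HomPoly 𝕜 k E 𝕜 := HomPoly.ofMultilinear (Φ.compContinuousMultilinearMap A)
  refine ⟨Q, ?_⟩
  have hQ : ∀ x, Q x = Φ (δ x) := fun x => by rw [hA]; rfl
  let Z := LinearMap.ker (NormedSpace.inclusionInDoubleDual 𝕜 _ Q - Φ).toLinearMap
  have hZ : Submodule.span 𝕜 Δ ≤ Z := by
    refine Submodule.span_le.mpr ?_
    rintro _ ⟨c, x, -, -, rfl⟩
    refine Z.smul_mem c ?_
    change (δ x) Q - Φ (δ x) = 0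
    rw [HomPoly.evalPoly_apply, hQ, sub_self]
  ext ξ
  have h1 := Submodule.topologicalClosure_minimal _ hZ
    (NormedSpace.inclusionInDoubleDual 𝕜 _ Q - Φ).isClosed_ker (hdense ξ)
  exact sub_eq_zero.mp h1

end Reflexive

/-- The hypothesis `h` is applied to the dual of the scalar polynomials; with `𝕜 : Type` this space
lives in the same universe as `E`. -/
theorem isReflexive_of_uncondConvPoly_subset {𝕜 : Type} [RCLike 𝕜] {E : Type u}
    [NormedAddCommGroup E] [NormedSpace 𝕜 E] {k : ℕ} (hk : 1 ≤ k)
    (hE : ∀ x : ℕ → E, IsWUC 𝕜 x → HasWeakSums 𝕜 x)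
    (h : ∀ (F : Type u) [NormedAddCommGroup F] [NormedSpace 𝕜 F] [CompleteSpace F],
      UncondConvPoly 𝕜 k E F ⊆ WeaklyCompactPoly 𝕜 k E F) :
    IsReflexive 𝕜 (HomPoly 𝕜 k E 𝕜) :=
  isReflexive_of_evalPoly_mem (h _ (mem_uncondConvPoly_of_hasWeakSums hk hE _))

end BanachPoly

end

theorem mainTheorem1 {𝕜 : Type} [RCLike 𝕜] (E : Type u)
    [NormedAddCommGroup E] [NormedSpace 𝕜 E] [CompleteSpace E] :
    (∀ k : ℕ, 1 < k →
      ((∀ (F : Type u) [NormedAddCommGroup F] [NormedSpace 𝕜 F] [CompleteSpace F],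
          BanachPoly.UncondConvPoly 𝕜 k E F ⊆ BanachPoly.WeaklyCompactPoly 𝕜 k E F) ↔
        BanachPoly.IsReflexive 𝕜 (BanachPoly.HomPoly 𝕜 k E 𝕜))) ∧
    (BanachPoly.PolynomialPropertyV 𝕜 E ↔
      ∀ k : ℕ, 1 ≤ k → BanachPoly.IsReflexive 𝕜 (BanachPoly.HomPoly 𝕜 k E 𝕜)) := by
  refine ⟨fun k hk => ⟨fun h => ?_, fun h F _ _ _ P _ => ?_⟩,
    fun h k hk => ?_, fun h k hk F _ _ _ P _ => ?_⟩
  · exact BanachPoly.isReflexive_of_uncondConvPoly_subset hk.le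
      (BanachPoly.hasWeakSums_of_uncondConvPoly_subset hk (h E)) h
  · exact BanachPoly.mem_weaklyCompactPoly_of_isReflexive h P
  -- Weak sums are drawn from degree two, whatever `k` is, so that degree one is covered as well.
  · exact BanachPoly.isReflexive_of_uncondConvPoly_subset hk
      (BanachPoly.hasWeakSums_of_uncondConvPoly_subset one_lt_two (h 2 one_le_two E)) (h k hk)
  · exact BanachPoly.mem_weaklyCompactPoly_of_isReflexive (h k hk) P
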